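/- Setting. Let $D,N,K\ge 1$, let $o_1,\dots,o_N\in\mathbb R^D$ be data vectors, $q\in\mathbb R^D$ a query, $dis(o)=\|o-q\|$, and let $P$ be a Haar-distributed random orthogonal $D\times D$ matrix. A distance comparison operation (DCO) on an object $o$ with threshold $r\in\mathbb R\cup\{+\infty\}$ has to decide whether $dis(o)\le r$ ($o$ is then *positive*, otherwise *negative*) and, if so, to return $dis(o)$; it *succeeds* if it does so correctly. Computing the exact distance costs $D$. *ADSampling* with parameter $\varepsilon_0>0$ works on $y=Po-Pq$: for $d=1,2,\dots$ it samples the coordinate $y_d$ and puts $dis'=\sqrt{D/d}\,\|(y_1,\dots,y_d)\|$; if $d<D$ and $dis'>(1+\varepsilon_0/\sqrt d)\,r$, it stops and answers "no"; if $d<D$ otherwise, it continues; if $d=D$, it returns $dis'$ if $dis'\le r$ and answers "no" otherwise. Its cost $\hat D$ is the number of sampled coordinates. For a negative object and $r>0$ the distance gap is $\alpha=(dis(o)-r)/r$. An AKNN algorithm that generates its candidates all at once first produces a list of $N_s$ distinct objects, the candidates. It then scans the list and maintains a set $\mathcal K$ of at most $K$ objects keyed by their distances. For each candidate it performs a DCO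 with threshold $r=\max\mathcal K$ ($r=+\infty$ while $|\mathcal K|<K$). If the answer is positive, the candidate is inserted when $|\mathcal K|<K$, or replaces a maximal element of $\mathcal K$ when its distance is smaller than $\max\mathcal K$. At the end it returns $\mathcal K$. AKNN uses exact DCOs; AKNN+ uses ADSampling for all of them, and generates its candidates from the transformed vectors $Po_1,\dots,Po_N,Pq$. The candidate generator may be randomized; the law of its list is required to be unchanged when data and query undergo the same orthogonal transformation (as for an inverted file, which uses only Euclidean distances). Besides the DCOs, one unit is charged per candidate, and $\lfloor\log_2K\rfloor+1$ units for each positive answer (the heap update). KNNs of the candidates are any $\min(K,N_s)$ of them that are at least as close to $q$ as all others. Statement. 1. For every orthogonal $P$, every $\varepsilon_0>0$ and every list of candidates: (a) if, for some choice $T$ of KNNs of the candidates, the DCOs of the run on the objects of $T$ succeed, then AKNN+ returns KNNs of the candidates; (b) a DCO of the run on a positive object costs at most $D$, and exactly $D$ if it succeeds; (c) the cost besides the DCOs is at most $N_s(\lfloor\log_2K\rfloor+2)$ for AKNN and for AKNN+; if all DCOs of the run succeed, then AKNN+ and AKNN, on the same list, end with the same set $\mathcal K$ and the same such cost. 2.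 There is an absolute constant $C>0$ such that for all $D,K\ge1$ and $\delta'\in(0,1]$ there is an $\varepsilon_0>0$, depending only on $D,K,\delta'$, such that, for all $N$, data, queries and candidate generators as above, AKNN+ fails to return KNNs of the generated candidates with probability at most $\delta'$, while for every object $o$, query and fixed threshold $r$ with $0<r<dis(o)$ and gap $\alpha=(dis(o)-r)/r$ $$\mathbb E[\hat D]\le C\min\Bigl(D,\ \max\bigl(1,\ \alpha^{-2}\log\tfrac{DK}{\delta'}\bigr)\Bigr).$$ Moreover, for each object and each $\alpha>0$, the same bound holds for the expected cost of the DCO on this object within the run of AKNN+, counted on the event that the object is a candidate and is negative with a positive threshold and distance gap at least $\alpha$ for the threshold that it meets in the run. -/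

import Mathlib

open MeasureTheory
open scoped ENNReal

noncomputable section

namespace AKNN

/-! ### The random orthogonal transformation -/

/-- The orthogonal group `O(D)`. -/
abbrev Orth (D : ℕ) := Matrix.orthogonalGroup (Fin D) ℝ

/-- Data and query vectors. -/
abbrev Vec (D : ℕ) := EuclideanSpace ℝ (Fin D)

instance (D : ℕ) : MeasurableSpace (Orth D) := borel _

instance (D : ℕ) : BorelSpace (Orth D) := ⟨rfl⟩

instance (D : ℕ) : CompactSpace (Orth D) := by
  have hsub : (Matrix.orthogonalGroup (Fin D) ℝ : Set (Matrix (Fin D) (Fin D) ℝ)) ⊆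
      Set.univ.pi fun _ : Fin D => Set.univ.pi fun _ : Fin D => Set.Icc (-1 : ℝ) 1 := by
    intro U hU i _ j _
    have h := entry_norm_bound_of_unitary (𝕜 := ℝ) hU i j
    rw [Real.norm_eq_abs, abs_le] at h
    exact h
  refine isCompact_iff_compactSpace.mp (IsCompact.of_isClosed_subset
    (isCompact_univ_pi fun _ => isCompact_univ_pi fun _ => isCompact_Icc) ?_ hsub)
  have hset : (Matrix.orthogonalGroup (Fin D) ℝ : Set (Matrix (Fin D) (Fin D) ℝ)) =
      {U | U * star U = 1} := by
    ext U
    exact Matrix.mem_orthogonalGroup_iff (Fin D) ℝ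
  rw [hset]
  exact isClosed_eq (by fun_prop) continuous_const

/-- The law of the random orthogonal matrix: the Haar probability measure on `O(D)`. -/
def haarOrth (D : ℕ) : Measure (Orth D) := Measure.haarMeasure ⊤

instance (D : ℕ) : IsProbabilityMeasure (haarOrth D) :=
  ⟨Measure.haarMeasure_self (K₀ := (⊤ : TopologicalSpace.PositiveCompacts (Orth D)))⟩

/-- The transformed vector `P x`. -/
def rotate {D : ℕ} (P : Orth D) (x : Vec D) : Vec D :=
  WithLp.toLp 2 (Matrix.mulVec (P : Matrix (Fin D) (Fin D) ℝ) x.ofLp)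

/-! ### Distance comparison operations -/

/-- A procedure for distance comparison: given an object, a query and a threshold (possibly `+∞`),
it answers `none` (for "no") or `some dis` (for "yes", together with a distance); the second
component is its cost, the number of coordinates that it evaluates. -/
abbrev DCO (D : ℕ) := Vec D → Vec D → EReal → Option ℝ × ℕ

/-- The answer that a distance comparison operation is required to give. -/
def correctAnswer (dis : ℝ) (r : EReal) : Option ℝ :=
  if (dis : EReal) ≤ r then some dis else none

/-- Computing the exact distance from all the `D` coordinates. -/
def fdScanning {D : ℕ} : DCO D := fun o q r => (correctAnswer (dist o q) r, D)

/-- The approximate distance `√(D/d) * ‖(y_1, …, y_d)‖` from the first `d` coordinates. -/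
def approxDist {D : ℕ} (y : Vec D) (d : ℕ) : ℝ :=
  √((D : ℝ) / d) * √(∑ i : Fin D with i.val < d, y i ^ 2)

/-- The hypothesis `dis ≤ r` is rejected on the basis of the first `d` coordinates. -/
def Rejects {D : ℕ} (ε₀ : ℝ) (y : Vec D) (r : EReal) (d : ℕ) : Prop :=
  ((1 + ε₀ / √(d : ℝ) : ℝ) : EReal) * r < (approxDist y d : EReal)

open Classical in
/-- The loop of `ADSampling`, entered with `d` coordinates of `y` already sampled; every iteration
samples one more coordinate. -/
def adLoop {D : ℕ} (ε₀ : ℝ) (y : Vec D) (r : EReal) (d : ℕ) : Option ℝ × ℕ :=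
  if d < D then
    if Rejects ε₀ y r (d + 1) ∧ d + 1 < D then (none, d + 1)
    else if d + 1 < D then adLoop ε₀ y r (d + 1)
    else (if (approxDist y (d + 1) : EReal) ≤ r then some (approxDist y (d + 1)) else none, d + 1)
  else (none, d)
termination_by D - d

/-- `ADSampling` with parameter `ε₀`, applied to a transformed object and a transformed query. The
cost is the number of sampled coordinates. -/
def adSampling {D : ℕ} (ε₀ : ℝ) : DCO D := fun o q r => adLoop ε₀ (o - q) r 0

/-- The distance gap between a distance and a (positive) threshold. -/
def distanceGap (dis r : ℝ) : ℝ := (dis - r) / r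

/-! ### Finding nearest neighbours among the candidates -/

/-- The maintained set of at most `K` objects, each with its distance as key. -/
abbrev KSet (N : ℕ) := List (Fin N × ℝ)

/-- The maximum key of the maintained set; `+∞` as long as the set is not full. -/
def threshold {N : ℕ} (K : ℕ) (H : KSet N) : EReal :=
  if H.length < K then ⊤
  else match H.argmax Prod.snd with
    | none => ⊤
    | some m => (m.2 : EReal)

/-- Update with an object: if the set is full, the object replaces one with the maximum key provided
that its own key is smaller. -/
def update {N : ℕ} (K : ℕ) (H : KSet N) (e : Fin N × ℝ) : KSet N :=
  if H.length < K then e :: H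
  else match H.argmax Prod.snd with
    | none => H
    | some m => if e.2 < m.2 then e :: H.erase m else H

/-- Processing one candidate: a distance comparison against the current threshold, and an update
if the answer is positive. -/
def step {D N : ℕ} (K : ℕ) (dco : DCO D) (X : Fin N → Vec D) (q : Vec D) (H : KSet N) (i : Fin N) :
    KSet N :=
  match (dco (X i) q (threshold K H)).1 with
  | none => H
  | some d => update K H (i, d)

/-- The maintained set after scanning the list `L` of candidates. -/
def scan {D N : ℕ} (K : ℕ) (dco : DCO D) (X : Fin N → Vec D) (q : Vec D) (L : List (Fin N)) :
    KSet N :=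
  L.foldl (step K dco X q) []

/-- The threshold that the scan of `L` uses for the candidate `i`. -/
def thresholdAt {D N : ℕ} (K : ℕ) (dco : DCO D) (X : Fin N → Vec D) (q : Vec D) (L : List (Fin N))
    (i : Fin N) : EReal :=
  threshold K (scan K dco X q (L.takeWhile (fun j => decide (j ≠ i))))

/-- Answer and cost of the distance comparison that the scan of `L` performs on the candidate `i`. -/
def dcoAt {D N : ℕ} (K : ℕ) (dco : DCO D) (X : Fin N → Vec D) (q : Vec D) (L : List (Fin N))
    (i : Fin N) : Option ℝ × ℕ :=
  dco (X i) q (thresholdAt K dco X q L i)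

/-- The cost, besides the distance comparisons, of scanning a list from the state `H`: for every
candidate one unit for reading the threshold and, if the answer is positive, `⌊log₂ K⌋ + 1` units
for the update of the max-heap. -/
def otherCostFrom {D N : ℕ} (K : ℕ) (dco : DCO D) (X : Fin N → Vec D) (q : Vec D) :
    KSet N → List (Fin N) → ℕ
  | _, [] => 0
  | H, i :: L =>
      1 + (if (dco (X i) q (threshold K H)).1.isSome then Nat.log 2 K + 1 else 0)
        + otherCostFrom K dco X q (step K dco X q H i) L

/-- The cost, besides the distance comparisons, of scanning `L`. -/
def otherCost {D N : ℕ} (K : ℕ) (dco : DCO D) (X : Fin N → Vec D) (q : Vec D) (L : List (Fin N)) :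
    ℕ :=
  otherCostFrom K dco X q [] L

/-! ### The algorithm with `ADSampling` on transformed vectors -/

/-- The threshold that the candidate `i` meets in the run with `ADSampling`. -/
def thresholdPlus {D N : ℕ} (K : ℕ) (ε₀ : ℝ) (P : Orth D) (X : Fin N → Vec D) (q : Vec D)
    (L : List (Fin N)) (i : Fin N) : EReal :=
  thresholdAt K (adSampling ε₀) (fun j => rotate P (X j)) (rotate P q) L i

/-- Answer and cost of the comparison on the candidate `i` in the run with `ADSampling`. -/
def dcoPlus {D N : ℕ} (K : ℕ) (ε₀ : ℝ) (P : Orth D) (X : Fin N → Vec D) (q : Vec D)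
    (L : List (Fin N)) (i : Fin N) : Option ℝ × ℕ :=
  dcoAt K (adSampling ε₀) (fun j => rotate P (X j)) (rotate P q) L i

/-- The comparison on the candidate `i` succeeds in the run with `ADSampling`. -/
def Succeeds {D N : ℕ} (K : ℕ) (ε₀ : ℝ) (P : Orth D) (X : Fin N → Vec D) (q : Vec D)
    (L : List (Fin N)) (i : Fin N) : Prop :=
  (dcoPlus K ε₀ P X q L i).1 = correctAnswer (dist (X i) q) (thresholdPlus K ε₀ P X q L i)

/-- The final state of the run with `ADSampling`. -/
def scanPlus {D N : ℕ} (K : ℕ) (ε₀ : ℝ) (P : Orth D) (X : Fin N → Vec D) (q : Vec D)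
    (L : List (Fin N)) : KSet N :=
  scan K (adSampling ε₀) (fun j => rotate P (X j)) (rotate P q) L

/-- The objects that the run with `ADSampling` returns. -/
def returnedPlus {D N : ℕ} (K : ℕ) (ε₀ : ℝ) (P : Orth D) (X : Fin N → Vec D) (q : Vec D)
    (L : List (Fin N)) : Finset (Fin N) :=
  ((scanPlus K ε₀ P X q L).map Prod.fst).toFinset

/-- The cost of the run with `ADSampling` besides the distance comparisons. -/
def otherCostPlus {D N : ℕ} (K : ℕ) (ε₀ : ℝ) (P : Orth D) (X : Fin N → Vec D) (q : Vec D)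
    (L : List (Fin N)) : ℕ :=
  otherCost K (adSampling ε₀) (fun j => rotate P (X j)) (rotate P q) L

/-- `T` consists of `K` nearest neighbours among the candidates in `L` (of all the candidates, if
there are fewer than `K`); equal distances may be resolved in any way. -/
def IsKNN {N : ℕ} (K : ℕ) (dis : Fin N → ℝ) (L : List (Fin N)) (T : Finset (Fin N)) : Prop :=
  T ⊆ L.toFinset ∧ T.card = min K L.toFinset.card ∧ ∀ i ∈ T, ∀ j ∈ L, j ∉ T → dis i ≤ dis j

/-- A randomized procedure that generates all candidates at once: from the data vectors and the
query it produces a list of distinct objects. It does not favour any orientation of the space: the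
law of the list is the same for orthogonally transformed data and query. This is so for an inverted
file, whose clusters and probed buckets are determined by Euclidean distances. -/
structure CandidateGenerator (D N : ℕ) where
  gen : (Fin N → Vec D) → Vec D → PMF (List (Fin N))
  nodup : ∀ X q, ∀ L ∈ (gen X q).support, L.Nodup
  invariant : ∀ (U : Orth D) X q, gen (fun i => rotate U (X i)) (rotate U q) = gen X q

/-- Expectation of a quantity that depends on the random orthogonal matrix `P` and on the list of
candidates, the latter generated from the transformed data and the transformed query. -/
def expectation {D N : ℕ} (G : CandidateGenerator D N) (X : Fin N → Vec D) (q : Vec D)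
    (f : Orth D → List (Fin N) → ℝ≥0∞) : ℝ≥0∞ :=
  ∫⁻ P, ∑' L : List (Fin N), G.gen (fun i => rotate P (X i)) (rotate P q) L * f P L ∂haarOrth D

open Classical in
/-- The probability that the scan with `ADSampling` does not return `K` nearest neighbours of the
query among the generated candidates. -/
def failureProbability {D N : ℕ} (K : ℕ) (ε₀ : ℝ) (G : CandidateGenerator D N)
    (X : Fin N → Vec D) (q : Vec D) : ℝ≥0∞ :=
  expectation G X q fun P L =>
    if IsKNN K (fun i => dist (X i) q) L (returnedPlus K ε₀ P X q L) then 0 else 1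

open Classical in
/-- The expected cost of the distance comparison on the object `i` in the run of the algorithm,
counted when this object is a candidate and is, for the threshold it meets in the run,
a negative object with distance gap at least `α`. -/
def expectedCostAt {D N : ℕ} (K : ℕ) (ε₀ : ℝ) (G : CandidateGenerator D N)
    (X : Fin N → Vec D) (q : Vec D) (i : Fin N) (α : ℝ) : ℝ≥0∞ :=
  expectation G X q fun P L =>
    if i ∈ L ∧ ∃ r : ℝ,
        thresholdPlus K ε₀ P X q L i = (r : EReal) ∧
        0 < r ∧ r < dist (X i) q ∧ α ≤ distanceGap (dist (X i) q) r then
      ((dcoPlus K ε₀ P X q L i).2 : ℝ≥0∞)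
    else 0

/-- The expected cost of `ADSampling` on an object `o`, a query `q` and a fixed threshold `r`. -/
def expectedCost {D : ℕ} (ε₀ : ℝ) (o q : Vec D) (r : ℝ) : ℝ≥0∞ :=
  ∫⁻ P, ((adSampling ε₀ (rotate P o) (rotate P q) (r : EReal)).2 : ℝ≥0∞) ∂haarOrth D

/-- The claimed order of the expected cost. -/
def costOrder (D K : ℕ) (δ α : ℝ) : ℝ :=
  min (D : ℝ) (max 1 (Real.log ((D : ℝ) * K / δ) / α ^ 2))

end AKNN

end

open AKNN
open scoped ENNReal

open MeasureTheory

namespace AKNN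

/-! ### Rotations -/

/-! Deterministic part. `ADSampling` says yes only after reading all `D` coordinates, where its
estimate is the true distance because `P` is an isometry. Hence every key is a true distance, and
the only possible error is a wrong rejection of a positive object. An object whose comparison
succeeds is refused or evicted only if the set is then full of objects at least as close. This is
the invariant `ScanInv`; it tolerates wrong rejections outside `T`, and at the end any lost member
of `T` certifies that the held objects are nearest neighbours (`ScanInv.isKNN`). If all answers are
right, the run agrees step by step with the exact one (`scan_congr`).

Probabilistic part. The thresholds met in a run depend on `P`, so tail bounds for a fixed threshold
do not apply to them. Both bad events are therefore enclosed in events that mention only `P` and the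
vector `u = o - q`: a wrong rejection forces `overestimates`, and a missing rejection at gap at
least `α` forces `undecided`. The list is independent of `P` because the generator is invariant. One
Chernoff bound, `haarOrth_partialSq_le`, controls both events with the tail `exp (-d (t - 1)² / 2)`;
it comes from comparing two Gaussian integrals, since the direction of `P x` has the same law for
all `x ≠ 0`.

Balance. With `t = 1 + ε₀ / √k` the overestimation probability is at most `exp (-ε₀² / 2)` for every
`k`. A union bound over at most `K` objects and fewer than `D` rounds then asks for `ε₀²` of order
`log (D K / δ)`. For a negative object the rejection margin costs at most half the gap once `k ≥ 4
ε₀² / α²`; from there on the survival probability is bounded by a geometric sequence, and the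
expected cost is `O(1 + (1 + ε₀²) / α²)`. -/

theorem rotate_sub {D : ℕ} (P : Orth D) (x y : Vec D) :
    rotate P x - rotate P y = rotate P (x - y) := by
  ext i
  simp [rotate, Matrix.mulVec_sub]

theorem norm_rotate {D : ℕ} (P : Orth D) (x : Vec D) : ‖rotate P x‖ = ‖x‖ := by
  have hP : (P : Matrix (Fin D) (Fin D) ℝ).transpose * (P : Matrix (Fin D) (Fin D) ℝ) = 1 :=
    (Matrix.mem_orthogonalGroup_iff' (Fin D) ℝ).mp P.2
  have h : ‖rotate P x‖ ^ 2 = ‖x‖ ^ 2 := by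
    rw [EuclideanSpace.real_norm_sq_eq, EuclideanSpace.real_norm_sq_eq]
    have h1 : ∀ v : Fin D → ℝ, ∑ i, v i ^ 2 = v ⬝ᵥ v := fun v => by
      simp [dotProduct, sq]
    rw [h1, h1]
    simp only [rotate]
    rw [Matrix.dotProduct_mulVec, Matrix.vecMul_mulVec, ← Matrix.dotProduct_mulVec, hP]
    simp
  exact (sq_eq_sq₀ (norm_nonneg _) (norm_nonneg _)).mp h

theorem approxDist_full {D : ℕ} (hD : 0 < D) (y : Vec D) : approxDist y D = ‖y‖ := by
  have hD' : (D : ℝ) ≠ 0 := by positivity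
  simp [approxDist, hD', EuclideanSpace.norm_eq]

/-! ### The sampling loop -/

theorem adLoop_snd_le {D : ℕ} (ε₀ : ℝ) (y : Vec D) (r : EReal) (d : ℕ) (hd : d ≤ D) :
    (adLoop ε₀ y r d).2 ≤ D := by
  induction h : D - d generalizing d with
  | zero => rw [adLoop, if_neg (by omega)]; exact hd
  | succ n ih =>
    rw [adLoop]
    split_ifs
    · simp; omega
    · exact ih (d + 1) (by omega) (by omega)
    · simp; omega
    · simp; omega
    · simpa using hd

open Classical in
/-- The loop samples at most one coordinate more than there are rounds without rejection. -/
theorem adLoop_snd_le_card {D : ℕ} (ε₀ : ℝ) (y : Vec D) (r : EReal) (d : ℕ) :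
    (adLoop ε₀ y r d).2 ≤ d + 1 + ((Finset.Ioo d D).filter fun k => ¬ Rejects ε₀ y r k).card := by
  induction h : D - d generalizing d with
  | zero =>
    rw [adLoop, if_neg (by omega)]
    simp; omega
  | succ n ih =>
    rw [adLoop]
    split_ifs with h1 h2 h3
    · simp
    · refine (ih (d + 1) (by omega)).trans ?_
      have hr : ¬ Rejects ε₀ y r (d + 1) := fun hr => h2 ⟨hr, h3⟩
      have : Finset.Ioo d D = insert (d + 1) (Finset.Ioo (d + 1) D) := by
        ext k; simp only [Finset.mem_Ioo, Finset.mem_insert]; omega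
      rw [this, Finset.filter_insert, if_pos hr, Finset.card_insert_of_notMem (by simp)]
      omega
    · simp
    · simp
    · simp; omega

/-- A positive answer is given only after all the coordinates are sampled. -/
theorem adLoop_eq_some {D : ℕ} (hD : 0 < D) {ε₀ : ℝ} {y : Vec D} {r : EReal} {d : ℕ} (hd : d ≤ D)
    {x : ℝ} (hx : (adLoop ε₀ y r d).1 = some x) :
    x = ‖y‖ ∧ (‖y‖ : EReal) ≤ r ∧ (adLoop ε₀ y r d).2 = D := by
  induction h : D - d generalizing d with
  | zero =>
    rw [adLoop, if_neg (by omega)] at hx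
    simp at hx
  | succ n ih =>
    have hdD : d < D := by omega
    rw [adLoop, if_pos hdD] at hx ⊢
    split_ifs at hx ⊢ with h2 h3 h4
    · exact ih (by omega) hx (by omega)
    · have hDd : d + 1 = D := by omega
      rw [hDd, approxDist_full hD] at h4 hx
      exact ⟨by simpa using hx.symm, h4, hDd⟩

/-- On a positive object the loop either gives the right answer or rejects wrongly. -/
theorem adLoop_eq_some_of_le {D : ℕ} (hD : 0 < D) {ε₀ : ℝ} {y : Vec D} {r : EReal} {d : ℕ}
    (hd : d < D) (hy : (‖y‖ : EReal) ≤ r) (hrej : ∀ k ∈ Finset.Ioo d D, ¬ Rejects ε₀ y r k) :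
    (adLoop ε₀ y r d).1 = some ‖y‖ := by
  induction h : D - d generalizing d with
  | zero => omega
  | succ n ih =>
    rw [adLoop, if_pos hd]
    split_ifs with h2 h3 h4
    · exact absurd h2.1 (hrej _ (by simp; omega))
    · exact ih h3 (fun k hk => hrej k (by simp at hk ⊢; omega)) (by omega)
    · have hDd : d + 1 = D := by omega
      simp [hDd, approxDist_full hD]
    · have hDd : d + 1 = D := by omega
      rw [hDd, approxDist_full hD] at h4
      exact absurd hy h4

theorem not_rejects_top {D : ℕ} {ε₀ : ℝ} (hε : 0 < ε₀) (y : Vec D) (k : ℕ) :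
    ¬ Rejects ε₀ y ⊤ k := by
  have : (0 : ℝ) < 1 + ε₀ / √(k : ℝ) := by positivity
  rw [Rejects, EReal.coe_mul_top_of_pos this]
  simp

/-! ### The maintained set -/

theorem threshold_of_lt {N K : ℕ} {H : KSet N} (h : H.length < K) : threshold K H = ⊤ := by
  simp [threshold, h]

theorem update_of_lt {N K : ℕ} {H : KSet N} (h : H.length < K) (e : Fin N × ℝ) :
    update K H e = e :: H := by
  simp [update, h]

theorem exists_max_of_le {N K : ℕ} {H : KSet N} (hK : 0 < K) (h : K ≤ H.length) :
    ∃ m ∈ H, (∀ e ∈ H, e.2 ≤ m.2) ∧ threshold K H = (m.2 : EReal) ∧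
      ∀ e, update K H e = if e.2 < m.2 then e :: H.erase m else H := by
  cases hm : H.argmax Prod.snd with
  | none =>
    rw [List.argmax_eq_none] at hm
    subst hm
    simp at h; omega
  | some m =>
    refine ⟨m, List.argmax_mem hm, fun e he => List.le_of_mem_argmax he hm, ?_, fun e => ?_⟩
    · simp [threshold, not_lt.mpr h, hm]
    · simp [update, not_lt.mpr h, hm]

/-- The answers of a comparison procedure are sound: a positive answer carries the distance, which
does not exceed the threshold, and an infinite threshold is answered positively. -/
structure SoundDCO {D N : ℕ} (dco : DCO D) (X : Fin N → Vec D) (q : Vec D) (dis : Fin N → ℝ) :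
    Prop where
  eq_dis : ∀ {i r x}, (dco (X i) q r).1 = some x → x = dis i
  top : ∀ i, (dco (X i) q ⊤).1 = some (dis i)

/-- What is known of the maintained set after the candidates in `A` have been scanned, if the
comparisons on the objects in `T` succeed. -/
structure ScanInv {N : ℕ} (K : ℕ) (dis : Fin N → ℝ) (T : Finset (Fin N)) (A : List (Fin N))
    (H : KSet N) : Prop where
  mem : ∀ e ∈ H, e.1 ∈ A ∧ e.2 = dis e.1
  nodup : (H.map Prod.fst).Nodup
  length_le : H.length ≤ K
  lost : ∀ i ∈ A, i ∈ T → i ∉ H.map Prod.fst → H.length = K ∧ ∀ e ∈ H, e.2 ≤ dis i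

/-- While the set is not full nothing is lost. Once it is full, its maximal key never increases, so
an object that was at least as far as all keys when it was lost remains so. Success is needed only
for members of `T`, to know that a refused one really exceeds the threshold. -/
theorem ScanInv.step {D N K : ℕ} (hK : 0 < K) {dco : DCO D} {X : Fin N → Vec D} {q : Vec D}
    {dis : Fin N → ℝ} (hdco : SoundDCO dco X q dis) {T : Finset (Fin N)} {A : List (Fin N)}
    {H : KSet N} (hH : ScanInv K dis T A H) {i : Fin N} (hi : i ∉ A)
    (hT : i ∈ T → (dco (X i) q (threshold K H)).1 = correctAnswer (dis i) (threshold K H)) :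
    ScanInv K dis T (A ++ [i]) (step K dco X q H i) := by
  have hiH : i ∉ H.map Prod.fst := by
    intro h
    obtain ⟨e, he, rfl⟩ := List.mem_map.mp h
    exact hi (hH.mem e he).1
  rcases lt_or_ge H.length K with hlt | hge
  · have hs : AKNN.step K dco X q H i = (i, dis i) :: H := by
      simp only [AKNN.step, threshold_of_lt hlt, hdco.top i]
      exact update_of_lt hlt _
    rw [hs]
    refine ⟨?_, ?_, by simpa using hlt, ?_⟩
    · intro e he
      rcases List.mem_cons.mp he with rfl | he
      · simp
      · exact ⟨List.mem_append_left _ (hH.mem e he).1, (hH.mem e he).2⟩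
    · simpa using ⟨by simpa using hiH, hH.nodup⟩
    · intro j hj hjT hjH
      simp only [List.map_cons, List.mem_cons, not_or] at hjH
      have hjA : j ∈ A := by
        rcases List.mem_append.mp hj with h | h
        · exact h
        · exact absurd (List.mem_singleton.mp h) hjH.1
      exact absurd (hH.lost j hjA hjT hjH.2).1 hlt.ne
  · obtain ⟨m, hm, hmax, hthr, hup⟩ := exists_max_of_le hK hge
    have hlen : H.length = K := le_antisymm hH.length_le hge
    -- The state is unchanged, or the object replaces the maximal element.
    have key : (AKNN.step K dco X q H i = H ∧ (i ∈ T → m.2 ≤ dis i)) ∨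
        (AKNN.step K dco X q H i = (i, dis i) :: H.erase m ∧ dis i < m.2) := by
      cases hans : (dco (X i) q (threshold K H)).1 with
      | none =>
        left
        refine ⟨by simp [AKNN.step, hans], fun hiT => ?_⟩
        have h := hT hiT
        rw [hans, hthr, correctAnswer] at h
        split_ifs at h with h'
        exact (not_le.mp (by simpa using h')).le
      | some x =>
        obtain rfl := hdco.eq_dis hans
        have hs : AKNN.step K dco X q H i = update K H (i, dis i) := by
          simp [AKNN.step, hans]
        rw [hs, hup]
        -- A positive answer need not change the set: the update asks for a strictly smaller key.
        by_cases hc : dis i < m.2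
        · right; simp [hc]
        · left; simpa [hc] using fun _ => not_lt.mp hc
    rcases key with ⟨hs, hiT⟩ | ⟨hs, hlt⟩
    · rw [hs]
      refine ⟨fun e he => ⟨List.mem_append_left _ (hH.mem e he).1, (hH.mem e he).2⟩, hH.nodup,
        hH.length_le, fun j hj hjT hjH => ?_⟩
      rcases List.mem_append.mp hj with h | h
      · exact hH.lost j h hjT hjH
      · obtain rfl := List.mem_singleton.mp h
        exact ⟨hlen, fun e he => (hmax e he).trans (hiT hjT)⟩
    · rw [hs]
      have hsub : ∀ e ∈ H.erase m, e ∈ H := fun e he => List.mem_of_mem_erase he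
      have hlen' : ((i, dis i) :: H.erase m).length = K := by
        rw [List.length_cons, List.length_erase_of_mem hm, hlen]; omega
      refine ⟨?_, ?_, hlen'.le, fun j hj hjT hjH => ⟨hlen', ?_⟩⟩
      · intro e he
        rcases List.mem_cons.mp he with rfl | he
        · simp
        · exact ⟨List.mem_append_left _ (hH.mem e (hsub e he)).1, (hH.mem e (hsub e he)).2⟩
      · rw [List.map_cons, List.nodup_cons]
        refine ⟨fun h => hiH ?_, hH.nodup.sublist (List.erase_sublist.map _)⟩
        obtain ⟨e, he, h'⟩ := List.mem_map.mp h
        exact List.mem_map.mpr ⟨e, hsub e he, h'⟩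
      · simp only [List.map_cons, List.mem_cons, not_or] at hjH
        have hjA : j ∈ A := by
          rcases List.mem_append.mp hj with h | h
          · exact h
          · exact absurd (List.mem_singleton.mp h) hjH.1
        have hmj : m.2 ≤ dis j := by
          by_cases hjm : j ∈ H.map Prod.fst
          · obtain ⟨e, he, rfl⟩ := List.mem_map.mp hjm
            -- An object held before and missing now can only be the evicted one.
            have hem : e = m := by
              by_contra hne
              exact hjH.2 (List.mem_map.mpr ⟨e, (List.mem_erase_of_ne hne).mpr he, rfl⟩)
            rw [← hem, (hH.mem e he).2]
          · exact (hH.lost j hjA hjT hjm).2 m hm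
        intro e he
        rcases List.mem_cons.mp he with rfl | he
        · exact hlt.le.trans hmj
        · exact (hmax e (hsub e he)).trans hmj

theorem takeWhile_ne_of_notMem {β : Type*} [DecidableEq β] {A B : List β} {i : β} (hi : i ∉ A) :
    (A ++ i :: B).takeWhile (fun j => decide (j ≠ i)) = A := by
  rw [List.takeWhile_append_of_pos]
  · simp
  · intro a ha
    simpa using fun h : a = i => hi (h ▸ ha)

/-- This links the threshold looked up by the name of an object with the state of the fold; without
repetitions in the list, the prefix before `i` is all that precedes its comparison. -/
theorem thresholdAt_append {D N K : ℕ} {dco : DCO D} {X : Fin N → Vec D} {q : Vec D}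
    {A B : List (Fin N)} {i : Fin N} (hi : i ∉ A) :
    thresholdAt K dco X q (A ++ i :: B) i = threshold K (scan K dco X q A) := by
  rw [thresholdAt, takeWhile_ne_of_notMem hi]

theorem scan_concat {D N K : ℕ} {dco : DCO D} {X : Fin N → Vec D} {q : Vec D}
    {A : List (Fin N)} {i : Fin N} :
    scan K dco X q (A ++ [i]) = step K dco X q (scan K dco X q A) i := by
  simp [scan]

theorem scanInv_scan {D N K : ℕ} (hK : 0 < K) {dco : DCO D} {X : Fin N → Vec D} {q : Vec D}
    {dis : Fin N → ℝ} (hdco : SoundDCO dco X q dis) {T : Finset (Fin N)} {L : List (Fin N)}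
    (hL : L.Nodup)
    (hT : ∀ i ∈ T, i ∈ L →
      (dcoAt K dco X q L i).1 = correctAnswer (dis i) (thresholdAt K dco X q L i)) :
    ScanInv K dis T L (scan K dco X q L) := by
  -- Induction on prefixes with `L` itself fixed, since `hT` speaks of thresholds in the run on `L`.
  suffices h : ∀ A B, L = A ++ B → ScanInv K dis T A (scan K dco X q A) from h L [] (by simp)
  intro A
  induction A using List.reverseRecOn with
  | nil => intro B _; exact ⟨by simp [scan], by simp [scan], by simp [scan], by simp⟩
  | append_singleton A i ih =>
    intro B hB
    rw [List.append_assoc, List.singleton_append] at hB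
    have hi : i ∉ A := by
      rw [hB, List.nodup_append] at hL
      exact fun h => hL.2.2 i h i (by simp) rfl
    rw [scan_concat]
    refine (ih _ hB).step hK hdco hi fun hiT => ?_
    have := hT i hiT (by simp [hB])
    rwa [dcoAt, hB, thresholdAt_append hi] at this

/-- If nothing of `T` is lost, cardinalities force equality with `T`. Otherwise some `i ∈ T` is
lost, so the set is full and its keys are at most `dis i`, hence at most the distance of anything
outside `T`; an absent member of `T` is itself lost and bounds the keys directly. -/
theorem ScanInv.isKNN {N K : ℕ} {dis : Fin N → ℝ} {T : Finset (Fin N)}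
    {L : List (Fin N)} {H : KSet N} (hH : ScanInv K dis T L H) (hT : IsKNN K dis L T) :
    IsKNN K dis L (H.map Prod.fst).toFinset := by
  obtain ⟨hTL, hTc, hTd⟩ := hT
  have hsub : (H.map Prod.fst).toFinset ⊆ L.toFinset := by
    intro i hi
    obtain ⟨e, he, rfl⟩ := List.mem_map.mp (List.mem_toFinset.mp hi)
    exact List.mem_toFinset.mpr (hH.mem e he).1
  have hcard : (H.map Prod.fst).toFinset.card = H.length := by
    rw [List.toFinset_card_of_nodup hH.nodup, List.length_map]
  by_cases hTH : T ⊆ (H.map Prod.fst).toFinset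
  · have : T = (H.map Prod.fst).toFinset := Finset.eq_of_subset_of_card_le hTH (by
      rw [hTc, hcard]
      exact le_min hH.length_le (hcard ▸ Finset.card_le_card hsub))
    rw [← this]
    exact ⟨hTL, hTc, hTd⟩
  · obtain ⟨i, hiT, hiH⟩ := Finset.not_subset.mp hTH
    obtain ⟨hlen, hmax⟩ := hH.lost i (List.mem_toFinset.mp (hTL hiT)) hiT (by simpa using hiH)
    refine ⟨hsub, ?_, ?_⟩
    · have := Finset.card_le_card hsub
      rw [hcard, hlen] at *
      exact (min_eq_left this).symm
    · intro a ha j hj hjH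
      obtain ⟨e, he, rfl⟩ := List.mem_map.mp (List.mem_toFinset.mp ha)
      rw [← (hH.mem e he).2]
      by_cases hjT : j ∈ T
      · exact (hH.lost j hj hjT (by simpa using hjH)).2 e he
      · exact (hmax e he).trans (hTd i hiT j hj hjT)

/-! ### The cost besides the distance comparisons -/

theorem otherCost_le {D N : ℕ} (K : ℕ) (dco : DCO D) (X : Fin N → Vec D) (q : Vec D)
    (L : List (Fin N)) : otherCost K dco X q L ≤ L.length * (Nat.log 2 K + 2) := by
  suffices h : ∀ H, otherCostFrom K dco X q H L ≤ L.length * (Nat.log 2 K + 2) from h []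
  induction L with
  | nil => simp [otherCostFrom]
  | cons i L ih =>
    intro H
    have := ih (step K dco X q H i)
    simp only [otherCostFrom, List.length_cons, add_mul, one_mul]
    split_ifs <;> omega

/-- Two procedures that give the same answers at the thresholds of the first run have the same
run. -/
theorem scan_congr {D N K : ℕ} {dco dco' : DCO D} {X X' : Fin N → Vec D} {q q' : Vec D}
    {L : List (Fin N)} (hL : L.Nodup)
    (h : ∀ i ∈ L, (dcoAt K dco X q L i).1 = (dco' (X' i) q' (thresholdAt K dco X q L i)).1) :
    scan K dco X q L = scan K dco' X' q' L ∧
      otherCost K dco X q L = otherCost K dco' X' q' L := by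
  suffices hs : ∀ B A, L = A ++ B →
      B.foldl (step K dco X q) (scan K dco X q A) =
        B.foldl (step K dco' X' q') (scan K dco X q A) ∧
      otherCostFrom K dco X q (scan K dco X q A) B =
        otherCostFrom K dco' X' q' (scan K dco X q A) B from hs L [] rfl
  intro B
  induction B with
  | nil => intro A _; simp [otherCostFrom]
  | cons i B ih =>
    intro A hA
    have hi : i ∉ A := by
      rw [hA, List.nodup_append] at hL
      exact fun h => hL.2.2 i h i (by simp) rfl
    have hans := h i (by simp [hA])
    rw [dcoAt, hA, thresholdAt_append hi] at hans
    have hstep : step K dco X q (scan K dco X q A) i =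
        step K dco' X' q' (scan K dco X q A) i := by
      simp only [step, hans]
    obtain ⟨h1, h2⟩ := ih (A ++ [i]) (by simp [hA])
    rw [scan_concat] at h1 h2
    constructor
    · rw [List.foldl_cons, List.foldl_cons, h1, hstep]
    · rw [otherCostFrom, otherCostFrom, h2, hans, hstep]

/-! ### Runs with `ADSampling` -/

theorem adSampling_rotate {D : ℕ} (ε₀ : ℝ) (P : Orth D) (o q : Vec D) (r : EReal) :
    adSampling ε₀ (rotate P o) (rotate P q) r = adLoop ε₀ (rotate P (o - q)) r 0 := by
  rw [adSampling, rotate_sub]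

theorem norm_rotate_sub {D : ℕ} (P : Orth D) (o q : Vec D) : ‖rotate P (o - q)‖ = dist o q := by
  rw [norm_rotate, dist_eq_norm]

theorem soundDCO_adSampling {D N : ℕ} (hD : 0 < D) {ε₀ : ℝ} (hε : 0 < ε₀) (P : Orth D)
    (X : Fin N → Vec D) (q : Vec D) :
    SoundDCO (adSampling ε₀) (fun j => rotate P (X j)) (rotate P q) (fun i => dist (X i) q) where
  eq_dis := by
    intro i r x h
    rw [adSampling_rotate] at h
    rw [(adLoop_eq_some hD (Nat.zero_le D) h).1, norm_rotate_sub]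
  top := by
    intro i
    rw [adSampling_rotate, adLoop_eq_some_of_le hD hD le_top
      (fun k _ => not_rejects_top hε _ k), norm_rotate_sub]

theorem isKNN_returnedPlus {D N K : ℕ} (hD : 0 < D) (hK : 0 < K) {ε₀ : ℝ} (hε : 0 < ε₀)
    (P : Orth D) (X : Fin N → Vec D) (q : Vec D) {L : List (Fin N)} (hL : L.Nodup)
    {T : Finset (Fin N)} (hT : IsKNN K (fun i => dist (X i) q) L T)
    (hs : ∀ i ∈ T, Succeeds K ε₀ P X q L i) :
    IsKNN K (fun i => dist (X i) q) L (returnedPlus K ε₀ P X q L) :=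
  (scanInv_scan hK (soundDCO_adSampling hD hε P X q) hL fun i hi _ => hs i hi).isKNN hT

theorem dcoPlus_eq {D N : ℕ} (K : ℕ) (ε₀ : ℝ) (P : Orth D) (X : Fin N → Vec D) (q : Vec D)
    (L : List (Fin N)) (i : Fin N) :
    dcoPlus K ε₀ P X q L i =
      adLoop ε₀ (rotate P (X i - q)) (thresholdPlus K ε₀ P X q L i) 0 := by
  rw [dcoPlus, dcoAt, adSampling_rotate, thresholdPlus]

theorem dcoPlus_snd_of_succeeds {D N K : ℕ} (hD : 0 < D) {ε₀ : ℝ} {P : Orth D}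
    {X : Fin N → Vec D} {q : Vec D} {L : List (Fin N)} {i : Fin N}
    (hpos : (dist (X i) q : EReal) ≤ thresholdPlus K ε₀ P X q L i)
    (h : Succeeds K ε₀ P X q L i) : (dcoPlus K ε₀ P X q L i).2 = D := by
  rw [Succeeds, correctAnswer, if_pos hpos, dcoPlus_eq] at h
  rw [dcoPlus_eq]
  exact (adLoop_eq_some hD (Nat.zero_le D) h).2.2

/-- A comparison can fail only by a wrong rejection of a positive object. -/
theorem succeeds_of_not_rejects {D N K : ℕ} (hD : 0 < D) {ε₀ : ℝ} {P : Orth D}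
    {X : Fin N → Vec D} {q : Vec D} {L : List (Fin N)} {i : Fin N}
    (h : (dist (X i) q : EReal) ≤ thresholdPlus K ε₀ P X q L i → ∀ k ∈ Finset.Ioo 0 D,
      ¬ Rejects ε₀ (rotate P (X i - q)) (thresholdPlus K ε₀ P X q L i) k) :
    Succeeds K ε₀ P X q L i := by
  rw [Succeeds, dcoPlus_eq, correctAnswer]
  split_ifs with hpos
  · rw [adLoop_eq_some_of_le hD hD (by rwa [norm_rotate_sub]) (h hpos), norm_rotate_sub]
  · cases hx : (adLoop ε₀ (rotate P (X i - q)) (thresholdPlus K ε₀ P X q L i) 0).1 with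
    | none => rfl
    | some x =>
      have := (adLoop_eq_some hD (Nat.zero_le D) hx).2.1
      rw [norm_rotate_sub] at this
      exact absurd this hpos

theorem exists_isKNN {N : ℕ} (K : ℕ) (dis : Fin N → ℝ) (L : List (Fin N)) :
    ∃ T, IsKNN K dis L T := by
  induction K with
  | zero => exact ⟨∅, by simp [IsKNN]⟩
  | succ K ih =>
    obtain ⟨T, hTL, hTc, hTd⟩ := ih
    rcases (L.toFinset \ T).eq_empty_or_nonempty with he | hne
    · have hT : T = L.toFinset := hTL.antisymm (Finset.sdiff_eq_empty_iff_subset.mp he)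
      refine ⟨T, hTL, ?_, hTd⟩
      rw [hT] at hTc ⊢
      omega
    · obtain ⟨a, ha, hmin⟩ := Finset.exists_min_image _ dis hne
      rw [Finset.mem_sdiff] at ha
      refine ⟨insert a T, Finset.insert_subset ha.1 hTL, ?_, ?_⟩
      · have h1 := Finset.card_le_card (Finset.insert_subset ha.1 hTL)
        rw [Finset.card_insert_of_notMem ha.2] at h1 ⊢
        omega
      · intro i hi j hj hjT
        rw [Finset.mem_insert, not_or] at hjT
        rcases Finset.mem_insert.mp hi with rfl | hi
        · exact hmin j (by simp [hj, hjT.2])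
        · exact hTd i hi j hj hjT.2

/-! ### The Haar measure on the orthogonal group -/

instance (D : ℕ) : SecondCountableTopology (Matrix (Fin D) (Fin D) ℝ) :=
  inferInstanceAs (SecondCountableTopology (Fin D → Fin D → ℝ))

instance (D : ℕ) : SecondCountableTopology (Orth D) :=
  Topology.IsInducing.subtypeVal.secondCountableTopology

theorem continuous_rotate {D : ℕ} : Continuous fun p : Orth D × Vec D => rotate p.1 p.2 := by
  unfold rotate; fun_prop

theorem continuous_rotate_left {D : ℕ} (x : Vec D) : Continuous fun P : Orth D => rotate P x := by
  unfold rotate; fun_prop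

/-- A right translate of the left-invariant Haar measure is again a Haar probability measure, and on
a compact group there is only one. -/
theorem haarOrth_map_mul_right {D : ℕ} (V : Orth D) :
    (haarOrth D).map (· * V) = haarOrth D := by
  have hm : AEMeasurable (fun P : Orth D => P * V) (haarOrth D) :=
    (continuous_mul_const V).measurable.aemeasurable
  have : IsProbabilityMeasure ((haarOrth D).map (· * V)) := Measure.isProbabilityMeasure_map hm
  have h1 : (haarOrth D).IsHaarMeasure := by unfold haarOrth; infer_instance
  have h2 : ((haarOrth D).map (· * V)).IsHaarMeasure := by unfold haarOrth; infer_instance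
  exact Measure.isHaarMeasure_eq_of_isProbabilityMeasure _ _

theorem rotate_mul {D : ℕ} (P V : Orth D) (x : Vec D) : rotate (P * V) x = rotate P (rotate V x) := by
  simp [rotate, Matrix.mulVec_mulVec]

theorem rotate_smul {D : ℕ} (P : Orth D) (c : ℝ) (x : Vec D) :
    rotate P (c • x) = c • rotate P x := by
  simp [rotate, Matrix.mulVec_smul]

/-- `rotate P` as a linear isometry. -/
noncomputable def rotateEquiv {D : ℕ} (P : Orth D) : Vec D ≃ₗᵢ[ℝ] Vec D :=
  LinearIsometry.toLinearIsometryEquiv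
    { toFun := rotate P
      map_add' := fun x y => by simp [rotate, Matrix.mulVec_add]
      map_smul' := fun c x => rotate_smul P c x
      norm_map' := norm_rotate P } rfl

theorem measurePreserving_rotate {D : ℕ} (P : Orth D) :
    MeasurePreserving (rotate P : Vec D → Vec D) volume volume :=
  (rotateEquiv P).measurePreserving

theorem exists_rotate_eq_isometry {D : ℕ} (f : Vec D ≃ₗᵢ[ℝ] Vec D) :
    ∃ V : Orth D, ∀ x, rotate V x = f x := by
  let b := EuclideanSpace.basisFun (Fin D) ℝ
  refine ⟨⟨b.toBasis.toMatrix (b.map f), b.toMatrix_orthonormalBasis_mem_orthogonal (b.map f)⟩,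
    fun x => ?_⟩
  ext i
  have hx : f x = ∑ j, x j • f (b j) := by
    conv_lhs => rw [← b.sum_repr x]
    simp [b]
  rw [hx]
  simp [rotate, Matrix.mulVec, dotProduct, Module.Basis.toMatrix_apply, b, mul_comm]

theorem exists_rotate_eq {D : ℕ} {u v : Vec D} (h : ‖u‖ = ‖v‖) : ∃ V : Orth D, rotate V u = v := by
  obtain ⟨V, hV⟩ := exists_rotate_eq_isometry ((ℝ ∙ (u - v))ᗮ.reflection)
  exact ⟨V, by rw [hV]; exact Submodule.reflection_sub h⟩

/-- The direction of a rotated nonzero vector has the same law for all nonzero vectors. -/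
theorem haarOrth_rotate_mem_eq {D : ℕ} {E : Set (Vec D)} (hE : MeasurableSet E)
    (hcone : ∀ (c : ℝ) x, 0 < c → x ∈ E → c • x ∈ E) {u v : Vec D} (hu : u ≠ 0) (hv : v ≠ 0) :
    haarOrth D {P | rotate P u ∈ E} = haarOrth D {P | rotate P v ∈ E} := by
  have hu' : 0 < ‖u‖ := norm_pos_iff.mpr hu
  have hv' : 0 < ‖v‖ := norm_pos_iff.mpr hv
  -- Right invariance replaces `u` by the multiple of `v` of the same norm; the cone property then
  -- removes the factor.
  obtain ⟨V, hV⟩ := exists_rotate_eq (u := u) (v := (‖u‖ / ‖v‖) • v) (by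
    rw [norm_smul, norm_div, norm_norm, norm_norm, div_mul_cancel₀ _ hv'.ne'])
  have hmeas : MeasurableSet {P : Orth D | rotate P u ∈ E} :=
    (continuous_rotate_left u).measurable hE
  have hpre : {P : Orth D | rotate P v ∈ E} = (· * V) ⁻¹' {P | rotate P u ∈ E} := by
    ext P
    simp only [Set.mem_ofPred_eq, Set.mem_preimage, rotate_mul, hV, rotate_smul]
    refine ⟨hcone _ _ (by positivity), fun h => ?_⟩
    have := hcone (‖v‖ / ‖u‖) _ (by positivity) h
    rwa [smul_smul, div_mul_div_cancel₀ hu'.ne', div_self hv'.ne', one_smul] at this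
  conv_lhs => rw [← haarOrth_map_mul_right V]
  rw [Measure.map_apply (continuous_mul_const V).measurable hmeas, hpre]

/-- Averaging an integral over the space by the random rotation. -/
theorem lintegral_haarOrth_rotate {D : ℕ} {h : Vec D → ℝ≥0∞} (hh : Measurable h) :
    ∫⁻ x : Vec D, ∫⁻ P, h (rotate P x) ∂haarOrth D = ∫⁻ x, h x := by
  rw [lintegral_lintegral_swap]
  · simp_rw [fun P => (measurePreserving_rotate (D := D) P).lintegral_comp hh]
    simp
  · have hc : Continuous fun p : Vec D × Orth D => rotate p.2 p.1 :=
      continuous_rotate.comp continuous_swap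
    exact (hh.comp hc.measurable).aemeasurable

/-! ### Gaussian integrals -/

theorem lintegral_exp_neg_weighted_sq {D : ℕ} {w : Fin D → ℝ} (hw : ∀ i, 0 < w i) :
    ∫⁻ x : Vec D, ENNReal.ofReal (Real.exp (-∑ i, w i * x i ^ 2)) =
      ENNReal.ofReal (∏ i, √(Real.pi / w i)) := by
  have hprod : ∀ x : Fin D → ℝ,
      Real.exp (-∑ i, w i * x i ^ 2) = ∏ i, Real.exp (-w i * x i ^ 2) := by
    intro x
    rw [← Real.exp_sum, ← Finset.sum_neg_distrib]
    simp
  have hmp := EuclideanSpace.volume_preserving_symm_measurableEquiv_toLp (Fin D)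
  have h1 := hmp.lintegral_comp_emb (MeasurableEquiv.measurableEmbedding _)
    (fun x : Fin D → ℝ => ENNReal.ofReal (Real.exp (-∑ i, w i * x i ^ 2)))
  refine Eq.trans (by rfl) (h1.trans ?_)
  simp_rw [hprod]
  rw [← ofReal_integral_eq_lintegral_ofReal]
  · rw [integral_fintype_prod_volume_eq_prod (fun i (y : ℝ) => Real.exp (-w i * y ^ 2))]
    simp_rw [integral_gaussian]
  · exact Integrable.fintype_prod fun i => integrable_exp_neg_mul_sq (hw i)
  · exact Filter.Eventually.of_forall fun x => by positivity

/-! ### Concentration of the first coordinates of a random rotation -/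

/-- The squared norm of the first `d` coordinates. -/
noncomputable def partialSq {D : ℕ} (d : ℕ) (y : Vec D) : ℝ :=
  ∑ i : Fin D with i.val < d, y i ^ 2

theorem continuous_partialSq {D : ℕ} (d : ℕ) : Continuous (partialSq d : Vec D → ℝ) := by
  unfold partialSq; fun_prop

theorem partialSq_smul {D : ℕ} (d : ℕ) (c : ℝ) (y : Vec D) :
    partialSq d (c • y) = c ^ 2 * partialSq d y := by
  simp [partialSq, mul_pow, Finset.mul_sum]

theorem card_val_lt {D d : ℕ} (hd : d ≤ D) :
    (Finset.univ.filter fun i : Fin D => i.val < d).card = d := by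
  rw [Fin.card_filter_val_lt]; omega

/-- The Chernoff bound for both tails of the squared norm of the first `d` coordinates: the squared
norm exceeds the fraction `t² d / D` of the total if `1 ≤ t`, or is below it if `t ≤ 1`. -/
theorem haarOrth_partialSq_le {D d : ℕ} (hD : 0 < D) (hd : d ≤ D) {t : ℝ} (ht : 0 < t) {u : Vec D}
    (hu : u ≠ 0) :
    haarOrth D {P | 0 ≤ (t ^ 2 - 1) * (partialSq d (rotate P u) - t ^ 2 * (d / D) * ‖u‖ ^ 2)} ≤
      ENNReal.ofReal (Real.exp (-(d * (t - 1) ^ 2 / 2))) := by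
  have hD' : (0 : ℝ) < D := by exact_mod_cast hD
  set E : Set (Vec D) := {y | 0 ≤ (t ^ 2 - 1) * (partialSq d y - t ^ 2 * (d / D) * ‖y‖ ^ 2)} with hE
  have hEm : MeasurableSet E := (isClosed_le continuous_const (by
    have := continuous_partialSq (D := D) d
    fun_prop)).measurableSet
  have hcone : ∀ (c : ℝ) x, 0 < c → x ∈ E → c • x ∈ E := by
    intro c x _ hx
    simp only [hE, Set.mem_ofPred_eq, partialSq_smul, norm_smul, mul_pow, Real.norm_eq_abs,
      sq_abs] at hx ⊢
    have := mul_nonneg (sq_nonneg c) hx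
    linarith
  have hset : {P : Orth D | 0 ≤ (t ^ 2 - 1) *
      (partialSq d (rotate P u) - t ^ 2 * (d / D) * ‖u‖ ^ 2)} = {P | rotate P u ∈ E} := by
    ext P; simp [hE, norm_rotate]
  rw [hset]
  -- The weight `1 / t²` is the Chernoff parameter, serving both tails: on `E` the weighted form is
  -- at most `(1 - (t² - 1) d / D) ‖y‖²`. Passing to `c` by `1 - x ≤ exp (-x)` keeps the coefficient
  -- positive and makes `D` cancel in `c ^ (D / 2)`.
  set w : Fin D → ℝ := fun i => if i.val < d then 1 / t ^ 2 else 1 with hw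
  have hwpos : ∀ i, 0 < w i := fun i => by simp only [hw]; split_ifs <;> positivity
  set c : ℝ := Real.exp (-((t ^ 2 - 1) * (d / D))) with hc
  have hcpos : 0 < c := Real.exp_pos _
  have hQ : ∀ y : Vec D, ∑ i, w i * y i ^ 2 = ‖y‖ ^ 2 - (1 - 1 / t ^ 2) * partialSq d y := by
    intro y
    rw [EuclideanSpace.real_norm_sq_eq, partialSq, Finset.sum_filter, Finset.mul_sum,
      ← Finset.sum_sub_distrib]
    refine Finset.sum_congr rfl fun i _ => ?_
    simp only [hw]
    split_ifs <;> ring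
  have hQE : ∀ y ∈ E, ∑ i, w i * y i ^ 2 ≤ ∑ i, c * y i ^ 2 := by
    intro y hy
    have h1 : 0 ≤ 1 / t ^ 2 * ((t ^ 2 - 1) * (partialSq d y - t ^ 2 * (d / D) * ‖y‖ ^ 2)) :=
      mul_nonneg (by positivity) hy
    have h2 : 1 / t ^ 2 * ((t ^ 2 - 1) * (partialSq d y - t ^ 2 * (d / D) * ‖y‖ ^ 2)) =
        (1 - 1 / t ^ 2) * partialSq d y - (t ^ 2 - 1) * (d / D) * ‖y‖ ^ 2 := by
      field_simp
    have h3 : 1 - (t ^ 2 - 1) * (d / D) ≤ c := by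
      have := Real.add_one_le_exp (-((t ^ 2 - 1) * ((d : ℝ) / D)))
      linarith
    have h4 := mul_le_mul_of_nonneg_right h3 (sq_nonneg ‖y‖)
    rw [hQ, ← Finset.mul_sum, ← EuclideanSpace.real_norm_sq_eq]
    linarith
  -- The weighted Gaussian integral is averaged over rotations and restricted to `P x ∈ E`, where
  -- its integrand dominates the isotropic one; the latter does not depend on `P`, so the
  -- probability factors out.
  have hkey : haarOrth D {P | rotate P u ∈ E} * ENNReal.ofReal (∏ _i : Fin D, √(Real.pi / c)) ≤
      ENNReal.ofReal (∏ i, √(Real.pi / w i)) := by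
    rw [← lintegral_exp_neg_weighted_sq hwpos,
      ← lintegral_exp_neg_weighted_sq (w := fun _ : Fin D => c) (fun _ => hcpos),
      ← lintegral_haarOrth_rotate (h := fun x : Vec D => ENNReal.ofReal (Real.exp (-∑ i, w i * x i ^ 2)))
        (by fun_prop), ← lintegral_const_mul _ (by fun_prop)]
    refine lintegral_mono fun x => ?_
    have hmu : haarOrth D {P | rotate P u ∈ E} ≤ haarOrth D {P | rotate P x ∈ E} := by
      by_cases hx : x = 0
      · have h0 : {P : Orth D | rotate P x ∈ E} = Set.univ := by
          ext P
          have : rotate P x = 0 := by rw [← norm_eq_zero, norm_rotate, hx, norm_zero]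
          simp [this, hE, partialSq]
        rw [h0]
        exact measure_mono (Set.subset_univ _)
      · exact (haarOrth_rotate_mem_eq hEm hcone hu hx).le
    calc haarOrth D {P | rotate P u ∈ E} * ENNReal.ofReal (Real.exp (-∑ i, c * x i ^ 2))
        ≤ haarOrth D {P | rotate P x ∈ E} * ENNReal.ofReal (Real.exp (-∑ i, c * x i ^ 2)) := by
          gcongr
      _ = ∫⁻ P in {P | rotate P x ∈ E},
            ENNReal.ofReal (Real.exp (-∑ i, c * x i ^ 2)) ∂haarOrth D := by
          rw [setLIntegral_const, mul_comm]
      _ ≤ ∫⁻ P in {P | rotate P x ∈ E},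
            ENNReal.ofReal (Real.exp (-∑ i, w i * rotate P x i ^ 2)) ∂haarOrth D := by
          refine setLIntegral_mono' ((continuous_rotate_left x).measurable hEm) fun P hP => ?_
          refine ENNReal.ofReal_le_ofReal (Real.exp_le_exp.mpr (neg_le_neg ?_))
          refine (hQE _ hP).trans (le_of_eq ?_)
          rw [← Finset.mul_sum, ← Finset.mul_sum, ← EuclideanSpace.real_norm_sq_eq,
            ← EuclideanSpace.real_norm_sq_eq, norm_rotate]
      _ ≤ _ := setLIntegral_le_lintegral _ _
  have hJ : 0 < ∏ _i : Fin D, √(Real.pi / c) := by positivity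
  have hratio : (∏ i, √(Real.pi / w i)) / ∏ _i : Fin D, √(Real.pi / c) ≤
      Real.exp (-(d * (t - 1) ^ 2 / 2)) := by
    have h1 : ∀ i, √(Real.pi / w i) / √(Real.pi / c) =
        Real.exp (-((t ^ 2 - 1) * (d / D)) / 2) * (if i.val < d then t else 1) := by
      intro i
      rw [← Real.sqrt_div (by have := hwpos i; positivity)]
      have : Real.pi / w i / (Real.pi / c) =
          (Real.exp (-((t ^ 2 - 1) * (d / D)) / 2) * (if i.val < d then t else 1)) ^ 2 := by
        rw [mul_pow, ← Real.exp_nat_mul]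
        simp only [hw, hc]
        split_ifs
        · field_simp; norm_num; field_simp
        · field_simp; norm_num; field_simp
      rw [this, Real.sqrt_sq]
      split_ifs <;> positivity
    rw [← Finset.prod_div_distrib, Finset.prod_congr rfl fun i _ => h1 i, Finset.prod_mul_distrib,
      Finset.prod_ite, Finset.prod_const, Finset.prod_const, Finset.prod_const, card_val_lt hd,
      Finset.card_univ, Fintype.card_fin, one_pow, mul_one, ← Real.exp_nat_mul]
    -- The ratio is `t ^ d * exp (-d (t² - 1) / 2)`, and `(t - 1) - (t² - 1) / 2 = -(t - 1)² / 2`.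
    have ht' : t ^ d ≤ Real.exp (d * (t - 1)) := by
      rw [Real.exp_nat_mul]
      have := Real.add_one_le_exp (t - 1)
      exact pow_le_pow_left₀ ht.le (by linarith) d
    refine (mul_le_mul_of_nonneg_left ht' (Real.exp_pos _).le).trans ?_
    rw [← Real.exp_add, Real.exp_le_exp]
    apply le_of_eq
    field_simp
    ring
  calc haarOrth D {P | rotate P u ∈ E}
      ≤ ENNReal.ofReal (∏ i, √(Real.pi / w i)) /
          ENNReal.ofReal (∏ _i : Fin D, √(Real.pi / c)) := by
        rw [ENNReal.le_div_iff_mul_le (Or.inl (ENNReal.ofReal_pos.mpr hJ).ne') (Or.inl ENNReal.ofReal_ne_top)]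
        exact hkey
    _ = ENNReal.ofReal ((∏ i, √(Real.pi / w i)) / ∏ _i : Fin D, √(Real.pi / c)) :=
        (ENNReal.ofReal_div_of_pos hJ).symm
    _ ≤ _ := ENNReal.ofReal_le_ofReal hratio

theorem approxDist_eq {D : ℕ} (y : Vec D) (d : ℕ) :
    approxDist y d = √(D / d) * √(partialSq d y) := rfl

theorem partialSq_nonneg {D : ℕ} (d : ℕ) (y : Vec D) : 0 ≤ partialSq d y :=
  Finset.sum_nonneg fun _ _ => sq_nonneg _

theorem continuous_approxDist {D : ℕ} (d : ℕ) : Continuous fun y : Vec D => approxDist y d := by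
  have := continuous_partialSq (D := D) d
  simp only [approxDist_eq]
  fun_prop

theorem partialSq_eq_approxDist_sq {D d : ℕ} (hD : 0 < D) (hd : 0 < d) (y : Vec D) :
    partialSq d y = d / D * approxDist y d ^ 2 := by
  have hD' : (0 : ℝ) < D := by exact_mod_cast hD
  have hd' : (0 : ℝ) < d := by exact_mod_cast hd
  rw [approxDist_eq, mul_pow, Real.sq_sqrt (by positivity), Real.sq_sqrt (partialSq_nonneg d y)]
  field_simp

/-- The upper tail of the approximate distance. -/
theorem haarOrth_lt_approxDist_le {D d : ℕ} (hd : 0 < d) (hdD : d ≤ D) {t : ℝ} (ht : 1 ≤ t)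
    (u : Vec D) :
    haarOrth D {P | t * ‖u‖ < approxDist (rotate P u) d} ≤
      ENNReal.ofReal (Real.exp (-(d * (t - 1) ^ 2 / 2))) := by
  have hD : 0 < D := by omega
  by_cases hu : u = 0
  · have : {P : Orth D | t * ‖u‖ < approxDist (rotate P u) d} = ∅ := by
      ext P
      have h0 : rotate P u = 0 := by rw [← norm_eq_zero, norm_rotate, hu, norm_zero]
      simp only [h0, Set.mem_ofPred_eq, Set.mem_empty_iff_false]
      simp [hu, approxDist]
    rw [this]; simp
  · refine (measure_mono fun P hP => ?_).trans
      (haarOrth_partialSq_le hD hdD (by linarith : 0 < t) hu)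
    simp only [Set.mem_ofPred_eq] at hP ⊢
    have h1 : (t * ‖u‖) ^ 2 ≤ approxDist (rotate P u) d ^ 2 :=
      pow_le_pow_left₀ (by positivity) hP.le 2
    rw [partialSq_eq_approxDist_sq hD hd]
    refine mul_nonneg (by nlinarith) ?_
    have h2 : (0 : ℝ) ≤ d / D := by positivity
    have := mul_le_mul_of_nonneg_left h1 h2
    linarith

/-- The lower tail of the approximate distance. -/
theorem haarOrth_approxDist_le_le {D d : ℕ} (hd : 0 < d) (hdD : d ≤ D) {s : ℝ} (hs : 0 < s)
    (hs1 : s ≤ 1) {u : Vec D} (hu : u ≠ 0) :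
    haarOrth D {P | approxDist (rotate P u) d ≤ s * ‖u‖} ≤
      ENNReal.ofReal (Real.exp (-(d * (s - 1) ^ 2 / 2))) := by
  have hD : 0 < D := by omega
  refine (measure_mono fun P hP => ?_).trans (haarOrth_partialSq_le hD hdD hs hu)
  simp only [Set.mem_ofPred_eq] at hP ⊢
  have h0 : 0 ≤ approxDist (rotate P u) d := by unfold approxDist; positivity
  have h1 : approxDist (rotate P u) d ^ 2 ≤ (s * ‖u‖) ^ 2 := pow_le_pow_left₀ h0 hP 2
  rw [partialSq_eq_approxDist_sq hD hd]
  refine mul_nonneg_of_nonpos_of_nonpos (by nlinarith) ?_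
  have h2 : (0 : ℝ) ≤ d / D := by positivity
  have := mul_le_mul_of_nonneg_left h1 h2
  linarith

/-! ### Expectations over the rotation and the candidates -/

/-- The list of candidates is independent of the rotation. -/
theorem expectation_eq {D N : ℕ} (G : CandidateGenerator D N) (X : Fin N → Vec D) (q : Vec D)
    (f : Orth D → List (Fin N) → ℝ≥0∞) :
    expectation G X q f = ∫⁻ P, ∑' L : List (Fin N), G.gen X q L * f P L ∂haarOrth D := by
  simp only [expectation, G.invariant]

/-- The measurable majorant `g` allows sum and integral to be interchanged without any measurability
of the run in `P`. -/
theorem expectation_le {D N : ℕ} {G : CandidateGenerator D N} {X : Fin N → Vec D} {q : Vec D}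
    {f : Orth D → List (Fin N) → ℝ≥0∞} (g : List (Fin N) → Orth D → ℝ≥0∞) {b : ℝ≥0∞}
    (hg : ∀ L, Measurable (g L)) (hfg : ∀ P L, L.Nodup → f P L ≤ g L P)
    (hb : ∀ L, ∫⁻ P, g L P ∂haarOrth D ≤ b) : expectation G X q f ≤ b := by
  rw [expectation_eq]
  calc ∫⁻ P, ∑' L : List (Fin N), G.gen X q L * f P L ∂haarOrth D
      ≤ ∫⁻ P, ∑' L : List (Fin N), G.gen X q L * g L P ∂haarOrth D := by
        refine lintegral_mono fun P => ENNReal.tsum_le_tsum fun L => ?_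
        by_cases hL : G.gen X q L = 0
        · simp [hL]
        · exact mul_le_mul_right (hfg P L (G.nodup X q L ((PMF.mem_support_iff _ _).mpr hL))) _
    _ = ∑' L : List (Fin N), G.gen X q L * ∫⁻ P, g L P ∂haarOrth D := by
        rw [lintegral_tsum fun L => ((hg L).const_mul _).aemeasurable]
        exact tsum_congr fun L => lintegral_const_mul _ (hg L)
    _ ≤ ∑' L : List (Fin N), G.gen X q L * b :=
        ENNReal.tsum_le_tsum fun L => mul_le_mul_right (hb L) _
    _ = b := by rw [ENNReal.tsum_mul_right, PMF.tsum_coe, one_mul]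

/-! ### The failure probability -/

/-- The approximate distance from `k` coordinates exceeds the distance by more than the factor
`1 + ε₀ / √k`. -/
def overestimates {D : ℕ} (ε₀ : ℝ) (u : Vec D) (k : ℕ) : Set (Orth D) :=
  {P | (1 + ε₀ / √(k : ℝ)) * ‖u‖ < approxDist (rotate P u) k}

theorem measurableSet_overestimates {D : ℕ} (ε₀ : ℝ) (u : Vec D) (k : ℕ) :
    MeasurableSet (overestimates ε₀ u k) :=
  (isOpen_lt continuous_const
    ((continuous_approxDist k).comp (continuous_rotate_left u))).measurableSet

theorem haarOrth_overestimates_le {D k : ℕ} (hk : 0 < k) (hkD : k ≤ D) {ε₀ : ℝ} (hε : 0 < ε₀)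
    (u : Vec D) :
    haarOrth D (overestimates ε₀ u k) ≤ ENNReal.ofReal (Real.exp (-(ε₀ ^ 2 / 2))) := by
  have hk' : (0 : ℝ) < k := by exact_mod_cast hk
  refine (haarOrth_lt_approxDist_le hk hkD (le_add_of_nonneg_right (by positivity)) u).trans
    (le_of_eq ?_)
  rw [add_sub_cancel_left, div_pow, Real.sq_sqrt hk'.le]
  congr 3
  field_simp

/-- Lowering the threshold to the distance only makes rejection easier; this removes the random
threshold from the event. -/
theorem mem_overestimates_of_rejects {D : ℕ} {ε₀ : ℝ} (hε : 0 < ε₀) {P : Orth D} {u : Vec D}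
    {r : EReal} {k : ℕ} (hr : (‖u‖ : EReal) ≤ r) (h : Rejects ε₀ (rotate P u) r k) :
    P ∈ overestimates ε₀ u k := by
  induction r with
  | bot => simp at hr
  | top => exact absurd h (not_rejects_top hε _ _)
  | coe r =>
    rw [Rejects, ← EReal.coe_mul, EReal.coe_lt_coe_iff] at h
    rw [EReal.coe_le_coe_iff] at hr
    exact (mul_le_mul_of_nonneg_left hr (by positivity)).trans_lt h

theorem failureProbability_le {D K : ℕ} (hD : 0 < D) (hK : 0 < K) {ε₀ : ℝ} (hε : 0 < ε₀) {N : ℕ}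
    (G : CandidateGenerator D N) (X : Fin N → Vec D) (q : Vec D) :
    failureProbability K ε₀ G X q ≤ K * (D * ENNReal.ofReal (Real.exp (-(ε₀ ^ 2 / 2)))) := by
  -- `T` depends on the list only, not on `P`, so the union bound runs over at most `K` fixed
  -- objects instead of all candidates.
  choose T hT using exists_isKNN (N := N) K (fun i => dist (X i) q)
  refine expectation_le (fun L P => ∑ i ∈ T L, ∑ k ∈ Finset.Ioo 0 D,
    (overestimates ε₀ (X i - q) k).indicator (fun _ => 1) P) (fun L => ?_) (fun P L hL => ?_)
    (fun L => ?_)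
  · exact Finset.measurable_sum _ fun i _ => Finset.measurable_sum _ fun k _ =>
      measurable_const.indicator (measurableSet_overestimates _ _ _)
  · by_cases h : ∃ i ∈ T L, ∃ k ∈ Finset.Ioo 0 D, P ∈ overestimates ε₀ (X i - q) k
    · obtain ⟨i, hi, k, hk, hP⟩ := h
      calc _ ≤ (1 : ℝ≥0∞) := by split_ifs <;> simp
        _ = (overestimates ε₀ (X i - q) k).indicator (fun _ => 1) P := by simp [hP]
        _ ≤ ∑ k ∈ Finset.Ioo 0 D, (overestimates ε₀ (X i - q) k).indicator (fun _ => 1) P :=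
          Finset.single_le_sum
            (f := fun k => (overestimates ε₀ (X i - q) k).indicator (fun _ => (1 : ℝ≥0∞)) P)
            (fun _ _ => zero_le) hk
        _ ≤ _ := Finset.single_le_sum (f := fun i => ∑ k ∈ Finset.Ioo 0 D,
            (overestimates ε₀ (X i - q) k).indicator (fun _ => (1 : ℝ≥0∞)) P)
            (fun _ _ => zero_le) hi
    · rw [if_pos]
      · exact zero_le
      · refine isKNN_returnedPlus hD hK hε P X q hL (hT L) fun i hi => ?_
        refine succeeds_of_not_rejects hD fun hpos k hk hrej => h ⟨i, hi, k, hk, ?_⟩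
        exact mem_overestimates_of_rejects hε (by rwa [← dist_eq_norm]) hrej
  · rw [lintegral_finsetSum _ fun i _ => Finset.measurable_sum _ fun k _ =>
      measurable_const.indicator (measurableSet_overestimates _ _ _)]
    have hi : ∀ i ∈ T L, ∫⁻ P, ∑ k ∈ Finset.Ioo 0 D,
        (overestimates ε₀ (X i - q) k).indicator (fun _ => 1) P ∂haarOrth D ≤
        D * ENNReal.ofReal (Real.exp (-(ε₀ ^ 2 / 2))) := by
      intro i _
      rw [lintegral_finsetSum _ fun k _ =>
        measurable_const.indicator (measurableSet_overestimates _ _ _)]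
      calc _ ≤ ∑ _k ∈ Finset.Ioo 0 D, ENNReal.ofReal (Real.exp (-(ε₀ ^ 2 / 2))) := by
            refine Finset.sum_le_sum fun k hk => ?_
            rw [Finset.mem_Ioo] at hk
            rw [lintegral_indicator_const (measurableSet_overestimates _ _ _), one_mul]
            exact haarOrth_overestimates_le hk.1 hk.2.le hε _
        _ ≤ _ := by
            rw [Finset.sum_const, nsmul_eq_mul]
            gcongr
            simp
    refine (Finset.sum_le_sum hi).trans ?_
    rw [Finset.sum_const, nsmul_eq_mul]
    gcongr
    rw [(hT L).2.1]
    exact min_le_left _ _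

/-! ### The expected cost -/

/-- The approximate distance from `k` coordinates allows no rejection at any threshold with
distance gap at least `α`. -/
def undecided {D : ℕ} (ε₀ α : ℝ) (u : Vec D) (k : ℕ) : Set (Orth D) :=
  {P | approxDist (rotate P u) k ≤ (1 + ε₀ / √(k : ℝ)) / (1 + α) * ‖u‖}

theorem measurableSet_undecided {D : ℕ} (ε₀ α : ℝ) (u : Vec D) (k : ℕ) :
    MeasurableSet (undecided ε₀ α u k) :=
  (isClosed_le ((continuous_approxDist k).comp (continuous_rotate_left u))
    continuous_const).measurableSet

theorem measurable_one_add_sum_undecided {D : ℕ} (ε₀ α : ℝ) (u : Vec D) :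
    Measurable fun P : Orth D => 1 + ∑ k ∈ Finset.Ioo 0 D,
      (undecided ε₀ α u k).indicator (fun _ => (1 : ℝ≥0∞)) P :=
  (Finset.measurable_sum _ fun _ _ =>
    measurable_const.indicator (measurableSet_undecided _ _ _ _)).const_add 1

theorem adLoop_cost_le {D : ℕ} {ε₀ α : ℝ} (hε : 0 < ε₀) (hα : 0 < α) {u : Vec D} {r : ℝ}
    (hr : 0 < r) (hgap : α ≤ distanceGap ‖u‖ r) (P : Orth D) :
    ((adLoop ε₀ (rotate P u) (r : EReal) 0).2 : ℝ≥0∞) ≤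
      1 + ∑ k ∈ Finset.Ioo 0 D, (undecided ε₀ α u k).indicator (fun _ => 1) P := by
  classical
  refine (Nat.cast_le.mpr (adLoop_snd_le_card ε₀ (rotate P u) r 0)).trans ?_
  rw [Finset.card_filter]
  push_cast
  gcongr with k hk
  split_ifs with h
  · exact zero_le
  · rw [Rejects, ← EReal.coe_mul, EReal.coe_lt_coe_iff, not_lt] at h
    have hmem : P ∈ undecided ε₀ α u k := by
      refine h.trans ?_
      rw [div_mul_eq_mul_div, mul_div_assoc]
      refine mul_le_mul_of_nonneg_left ?_ (by positivity)
      rw [distanceGap, le_div_iff₀ hr] at hgap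
      rw [le_div_iff₀ (by positivity)]
      linarith
    simp [hmem]

theorem sum_ite_lt_le {D : ℕ} {M : ℝ} (hM : 0 ≤ M) :
    ∑ k ∈ Finset.Ioo 0 D, (if (k : ℝ) < M then (1 : ℝ) else 0) ≤ M := by
  rw [Finset.sum_boole]
  have hsub : (Finset.Ioo 0 D).filter (fun k : ℕ => (k : ℝ) < M) ⊆ Finset.Ioc 0 ⌊M⌋₊ := by
    intro k hk
    simp only [Finset.mem_filter, Finset.mem_Ioo, Finset.mem_Ioc] at hk ⊢
    exact ⟨hk.1.1, Nat.le_floor hk.2.le⟩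
  have := Finset.card_le_card hsub
  rw [Nat.card_Ioc, Nat.sub_zero] at this
  exact (Nat.cast_le.mpr this).trans (Nat.floor_le hM)

/-- Geometric series, with `exp (-κ) ≤ 1 / (1 + κ)`. -/
theorem sum_exp_neg_mul_le {D : ℕ} {κ : ℝ} (hκ : 0 < κ) :
    ∑ k ∈ Finset.Ioo 0 D, Real.exp (-(k * κ)) ≤ 1 + 1 / κ := by
  set x := Real.exp (-κ) with hx
  have hx0 : 0 < x := Real.exp_pos _
  have hx1 : x * (1 + κ) ≤ 1 := by
    have h := Real.add_one_le_exp κ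
    have h2 : x * Real.exp κ = 1 := by rw [hx, ← Real.exp_add]; simp
    nlinarith
  have hpow : ∀ k : ℕ, Real.exp (-(k * κ)) = x ^ k := fun k => by
    rw [hx, ← Real.exp_nat_mul]; congr 1; ring
  simp_rw [hpow]
  have h1 : ∑ k ∈ Finset.Ioo 0 D, x ^ k ≤ ∑ k ∈ Finset.range D, x ^ k :=
    Finset.sum_le_sum_of_subset_of_nonneg (fun k hk => by simp at hk ⊢; omega)
      fun k _ _ => by positivity
  have h2 := geom_sum_mul x D
  have h3 : 0 < x ^ D := by positivity
  refine h1.trans ?_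
  have hlt : 0 < 1 - x := by nlinarith
  have h4 : ∑ k ∈ Finset.range D, x ^ k ≤ 1 / (1 - x) := by
    rw [le_div_iff₀ hlt]; linarith
  refine h4.trans ?_
  rw [div_le_iff₀ hlt]
  have : (1 + 1 / κ) * (1 - x) * κ = (1 + κ) * (1 - x) := by field_simp; ring
  have h5 : κ ≤ (1 + 1 / κ) * (1 - x) * κ := by rw [this]; linarith
  exact le_of_mul_le_mul_right (by linarith) hκ

/-- For such `k` one has `ε₀ / √k ≤ α / 2`, so the lower tail applies with `s = (1 + α / 2) / (1 +
α)`, where `1 - s = α / (2 (1 + α))`. -/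
theorem haarOrth_undecided_le {D k : ℕ} (hk : 0 < k) (hkD : k ≤ D) {ε₀ α : ℝ}
    (hα : 0 < α) {u : Vec D} (hu : u ≠ 0) (hkα : 4 * ε₀ ^ 2 / α ^ 2 ≤ k) :
    haarOrth D (undecided ε₀ α u k) ≤
      ENNReal.ofReal (Real.exp (-(k * (α ^ 2 / (8 * (1 + α) ^ 2))))) := by
  have hk' : (0 : ℝ) < k := by exact_mod_cast hk
  have hεk : ε₀ / √(k : ℝ) ≤ α / 2 := by
    rw [div_le_iff₀ (by positivity)]
    rw [div_le_iff₀ (by positivity)] at hkα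
    refine abs_le_of_sq_le_sq' ?_ (by positivity) |>.2
    rw [mul_pow, Real.sq_sqrt hk'.le]
    nlinarith
  have hs1 : (1 + α / 2) / (1 + α) ≤ 1 := by
    rw [div_le_one (by positivity)]; linarith
  refine (measure_mono fun P hP => ?_).trans
    ((haarOrth_approxDist_le_le hk hkD (s := (1 + α / 2) / (1 + α)) (by positivity) hs1 hu).trans
      (le_of_eq ?_))
  · refine le_trans (show approxDist (rotate P u) k ≤ _ from hP) ?_
    gcongr
  · congr 3
    have h : (1 + α / 2) / (1 + α) - 1 = -(α / (2 * (1 + α))) := by field_simp; ring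
    rw [h, neg_sq, div_pow, mul_pow]
    field_simp
    norm_num

/-- Rounds with `k < 4 ε₀² / α²` are counted in full, the others by the geometric tail. The total is
`2 + 4 ε₀² / α² + 8 (1 + α)² / α²`, and `(1 + α)² ≤ 2 + 2 α²`. -/
theorem lintegral_undecided_le {D : ℕ} {ε₀ α : ℝ} (hα : 0 < α) {u : Vec D} (hu : u ≠ 0) :
    ∫⁻ P, (1 + ∑ k ∈ Finset.Ioo 0 D, (undecided ε₀ α u k).indicator (fun _ => 1) P) ∂haarOrth D ≤
      ENNReal.ofReal (18 + (4 * ε₀ ^ 2 + 16) / α ^ 2) := by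
  have hκ : 0 < α ^ 2 / (8 * (1 + α) ^ 2) := by positivity
  rw [lintegral_add_left measurable_const, lintegral_finsetSum _ fun k _ =>
    measurable_const.indicator (measurableSet_undecided _ _ _ _)]
  have hk : ∀ k ∈ Finset.Ioo 0 D,
      ∫⁻ P, (undecided ε₀ α u k).indicator (fun _ => 1) P ∂haarOrth D ≤
        ENNReal.ofReal ((if (k : ℝ) < 4 * ε₀ ^ 2 / α ^ 2 then 1 else 0) +
          Real.exp (-(k * (α ^ 2 / (8 * (1 + α) ^ 2))))) := by
    intro k hk
    rw [Finset.mem_Ioo] at hk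
    rw [lintegral_indicator_const (measurableSet_undecided _ _ _ _), one_mul]
    split_ifs with h
    · refine prob_le_one.trans ?_
      rw [ENNReal.one_le_ofReal]
      linarith [Real.exp_pos (-(k * (α ^ 2 / (8 * (1 + α) ^ 2))))]
    · rw [zero_add]
      exact haarOrth_undecided_le hk.1 hk.2.le hα hu (not_lt.mp h)
  refine (add_le_add_right (Finset.sum_le_sum hk) _).trans ?_
  rw [← ENNReal.ofReal_sum_of_nonneg fun k _ => by positivity, lintegral_const, measure_univ,
    mul_one, ← ENNReal.ofReal_one, ← ENNReal.ofReal_add zero_le_one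
      (Finset.sum_nonneg fun k _ => by positivity), Finset.sum_add_distrib]
  refine ENNReal.ofReal_le_ofReal ?_
  have h1 := sum_ite_lt_le (D := D) (M := 4 * ε₀ ^ 2 / α ^ 2) (by positivity)
  have h2 := sum_exp_neg_mul_le (D := D) hκ
  have h3 : 1 / (α ^ 2 / (8 * (1 + α) ^ 2)) ≤ 16 + 16 / α ^ 2 := by
    rw [one_div_div, div_le_iff₀ (by positivity)]
    have : (16 + 16 / α ^ 2) * α ^ 2 = 16 * α ^ 2 + 16 := by field_simp
    nlinarith [sq_nonneg (α - 1)]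
  have h4 : (4 * ε₀ ^ 2 + 16) / α ^ 2 = 4 * ε₀ ^ 2 / α ^ 2 + 16 / α ^ 2 := by ring
  linarith

/-- The parameter of `ADSampling` that achieves the trade-off. -/
noncomputable def samplingParameter (D K : ℕ) (δ : ℝ) : ℝ :=
  √(2 * (Real.log ((D : ℝ) * K / δ) + 1))

theorem natCast_le_mul_div {D K : ℕ} {δ : ℝ} (hD : 0 < D) (hK : 0 < K) (hδ : 0 < δ)
    (hδ1 : δ ≤ 1) : (D : ℝ) ≤ D * K / δ := by
  have hK' : (1 : ℝ) ≤ K := by exact_mod_cast hK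
  rw [le_div_iff₀ hδ]
  have hD' : (0 : ℝ) ≤ D := by positivity
  exact mul_le_mul_of_nonneg_left (hδ1.trans hK') hD'

theorem log_nonneg_of_pos {D K : ℕ} {δ : ℝ} (hD : 0 < D) (hK : 0 < K) (hδ : 0 < δ)
    (hδ1 : δ ≤ 1) : 0 ≤ Real.log ((D : ℝ) * K / δ) :=
  Real.log_nonneg (le_trans (by exact_mod_cast hD) (natCast_le_mul_div hD hK hδ hδ1))

/-- The summand `1` in the parameter matters when `D = K = δ = 1`, where the logarithm vanishes. -/
theorem samplingParameter_pos {D K : ℕ} {δ : ℝ} (hD : 0 < D) (hK : 0 < K) (hδ : 0 < δ)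
    (hδ1 : δ ≤ 1) : 0 < samplingParameter D K δ := by
  have := log_nonneg_of_pos hD hK hδ hδ1
  exact Real.sqrt_pos.mpr (by linarith)

theorem samplingParameter_sq {D K : ℕ} {δ : ℝ} (hD : 0 < D) (hK : 0 < K) (hδ : 0 < δ)
    (hδ1 : δ ≤ 1) :
    samplingParameter D K δ ^ 2 = 2 * (Real.log ((D : ℝ) * K / δ) + 1) := by
  have := log_nonneg_of_pos hD hK hδ hδ1
  exact Real.sq_sqrt (by linarith)

theorem failureProbability_le_of_samplingParameter {D K : ℕ} {δ : ℝ} (hD : 0 < D) (hK : 0 < K) (hδ : 0 < δ)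
    (hδ1 : δ ≤ 1) {N : ℕ} (G : CandidateGenerator D N)
    (X : Fin N → Vec D) (q : Vec D) :
    failureProbability K (samplingParameter D K δ) G X q ≤ ENNReal.ofReal δ := by
  refine (failureProbability_le hD hK (samplingParameter_pos hD hK hδ hδ1) G X q).trans ?_
  have hD' : (0 : ℝ) < D := by exact_mod_cast hD
  have hK' : (0 : ℝ) < K := by exact_mod_cast hK
  rw [← ENNReal.ofReal_natCast, ← ENNReal.ofReal_natCast,
    ← ENNReal.ofReal_mul hD'.le, ← ENNReal.ofReal_mul hK'.le]
  refine ENNReal.ofReal_le_ofReal ?_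
  have h : Real.exp (-(samplingParameter D K δ ^ 2 / 2)) ≤ δ / (D * K) := by
    rw [samplingParameter_sq hD hK hδ hδ1, ← Real.exp_log (show 0 < δ / (D * K) by positivity),
      Real.exp_le_exp, ← inv_div ((D : ℝ) * K) δ, Real.log_inv]
    linarith
  calc (K : ℝ) * (D * Real.exp (-(samplingParameter D K δ ^ 2 / 2)))
      ≤ K * (D * (δ / (D * K))) := by gcongr
    _ = δ := by field_simp

/-- Write `ℓ` for the logarithm. The numerator is `8 ℓ + 24`, at most `56 ℓ` when `ℓ ≥ 1 / 2`, and
`74 = 18 + 56`. For `D ≥ 2` this holds by `ℓ ≥ log 2`; for `D = 1`, where `ℓ` may vanish, the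
trivial bound `E ≤ D` suffices. -/
theorem le_costOrder {D K : ℕ} {δ : ℝ} (hD : 0 < D) (hK : 0 < K) (hδ : 0 < δ)
    (hδ1 : δ ≤ 1) {E : ℝ≥0∞} {α : ℝ} (hE : E ≤ D)
    (hE' : E ≤ ENNReal.ofReal (18 + (4 * samplingParameter D K δ ^ 2 + 16) / α ^ 2)) :
    E ≤ ENNReal.ofReal (74 * costOrder D K δ α) := by
  have hD' : (1 : ℝ) ≤ D := by exact_mod_cast hD
  rw [← ENNReal.ofReal_natCast] at hE
  rcases le_total (D : ℝ) (max 1 (Real.log ((D : ℝ) * K / δ) / α ^ 2)) with h | h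
  · refine hE.trans (ENNReal.ofReal_le_ofReal ?_)
    rw [costOrder, min_eq_left h]
    linarith
  · rw [costOrder, min_eq_right h]
    have hmax := le_max_left 1 (Real.log ((D : ℝ) * K / δ) / α ^ 2)
    have hmax' := le_max_right 1 (Real.log ((D : ℝ) * K / δ) / α ^ 2)
    obtain rfl | hD2 : D = 1 ∨ 2 ≤ D := by omega
    · refine hE.trans (ENNReal.ofReal_le_ofReal ?_)
      push_cast at hmax ⊢
      linarith
    · refine hE'.trans (ENNReal.ofReal_le_ofReal ?_)
      have hlog : (1 : ℝ) / 2 ≤ Real.log ((D : ℝ) * K / δ) := by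
        have h2 : Real.log 2 ≤ Real.log ((D : ℝ) * K / δ) :=
          Real.log_le_log two_pos
            (le_trans (by exact_mod_cast hD2) (natCast_le_mul_div hD hK hδ hδ1))
        linarith [Real.log_two_gt_d9]
      have hnum : (4 * samplingParameter D K δ ^ 2 + 16) / α ^ 2 ≤
          56 * (Real.log ((D : ℝ) * K / δ) / α ^ 2) := by
        rw [← mul_div_assoc]
        refine div_le_div_of_nonneg_right ?_ (sq_nonneg α)
        rw [samplingParameter_sq hD hK hδ hδ1]
        linarith
      linarith

theorem expectedCostAt_le {D K : ℕ} {δ : ℝ} (hD : 0 < D) (hK : 0 < K) (hδ : 0 < δ)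
    (hδ1 : δ ≤ 1) {N : ℕ} (G : CandidateGenerator D N) (X : Fin N → Vec D) (q : Vec D)
    (i : Fin N) {α : ℝ} (hα : 0 < α) :
    expectedCostAt K (samplingParameter D K δ) G X q i α ≤
      ENNReal.ofReal (74 * costOrder D K δ α) := by
  refine le_costOrder hD hK hδ hδ1 ?_ ?_
  · refine expectation_le (fun _ _ => (D : ℝ≥0∞)) (fun _ => measurable_const) (fun P L _ => ?_)
      (fun L => by simp)
    split_ifs
    · rw [dcoPlus_eq]
      exact Nat.cast_le.mpr (adLoop_snd_le _ _ _ _ (Nat.zero_le D))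
    · exact zero_le
  · have hε := samplingParameter_pos hD hK hδ hδ1
    -- The tail bound needs a nonzero vector; an object equal to the query is never negative at a
    -- positive threshold.
    by_cases hu : X i - q = 0
    · refine expectation_le (fun _ _ => 0) (fun _ => measurable_const) (fun P L _ => ?_)
        (fun L => by simp)
      rw [if_neg]
      rintro ⟨-, r, -, hr, hr', -⟩
      rw [dist_eq_norm, hu, norm_zero] at hr'
      exact lt_asymm hr hr'
    · refine expectation_le _ (fun _ => measurable_one_add_sum_undecided _ α (X i - q))
        (fun P L _ => ?_) (fun _ => lintegral_undecided_le hα hu)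
      split_ifs with h
      · obtain ⟨-, r, hthr, hr, -, hgap⟩ := h
        rw [dcoPlus_eq, hthr]
        rw [dist_eq_norm] at hgap
        exact adLoop_cost_le hε hα hr hgap P
      · exact zero_le

theorem expectedCost_le {D K : ℕ} {δ : ℝ} (hD : 0 < D) (hK : 0 < K) (hδ : 0 < δ)
    (hδ1 : δ ≤ 1) {o q : Vec D} {r : ℝ} (hr : 0 < r) (hro : r < dist o q) :
    expectedCost (samplingParameter D K δ) o q r ≤
      ENNReal.ofReal (74 * costOrder D K δ (distanceGap (dist o q) r)) := by
  have hε := samplingParameter_pos hD hK hδ hδ1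
  have hα : 0 < distanceGap (dist o q) r := div_pos (sub_pos.mpr hro) hr
  have hu : o - q ≠ 0 := norm_pos_iff.mp (by rw [← dist_eq_norm]; exact hr.trans hro)
  simp only [expectedCost, adSampling_rotate]
  refine le_costOrder hD hK hδ hδ1 ?_ ?_
  · refine (lintegral_mono fun P => Nat.cast_le.mpr
      (adLoop_snd_le _ _ _ _ (Nat.zero_le D))).trans ?_
    simp
  · refine (lintegral_mono fun P => adLoop_cost_le hε hα hr ?_ P).trans
      (lintegral_undecided_le hα hu)
    rw [dist_eq_norm]

end AKNN

theorem corollary4p2 :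
    -- Statements about every run, for every orthogonal matrix and every list of candidates.
    (∀ (D N K : ℕ) (ε₀ : ℝ) (P : Orth D) (X : Fin N → Vec D) (q : Vec D) (L : List (Fin N)),
      0 < D → 0 < K → 0 < ε₀ → L.Nodup →
      -- It suffices that the comparisons on the true nearest neighbours succeed.
      (∀ T : Finset (Fin N), IsKNN K (fun i => dist (X i) q) L T →
        (∀ i ∈ T, Succeeds K ε₀ P X q L i) →
        IsKNN K (fun i => dist (X i) q) L (returnedPlus K ε₀ P X q L)) ∧
      -- A comparison on a positive object costs no more than an exact one,
      -- and just as much if it succeeds.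
      (∀ i ∈ L, (dist (X i) q : EReal) ≤ thresholdPlus K ε₀ P X q L i →
        (dcoPlus K ε₀ P X q L i).2 ≤ (fdScanning (X i) q (thresholdPlus K ε₀ P X q L i)).2 ∧
        (Succeeds K ε₀ P X q L i → (dcoPlus K ε₀ P X q L i).2 =
          (fdScanning (X i) q (thresholdPlus K ε₀ P X q L i)).2)) ∧
      -- The remaining cost obeys the same bound as with exact comparisons, and the whole
      -- computation is the same if all comparisons succeed.
      otherCost K fdScanning X q L ≤ L.length * (Nat.log 2 K + 2) ∧
      otherCostPlus K ε₀ P X q L ≤ L.length * (Nat.log 2 K + 2) ∧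
      ((∀ i ∈ L, Succeeds K ε₀ P X q L i) →
        scanPlus K ε₀ P X q L = scan K fdScanning X q L ∧
        otherCostPlus K ε₀ P X q L = otherCost K fdScanning X q L)) ∧
    -- The trade-off between the failure probability and the expected cost.
    (∃ C : ℝ, 0 < C ∧ ∀ (D K : ℕ) (δ : ℝ), 0 < D → 0 < K → 0 < δ → δ ≤ 1 →
      ∃ ε₀ : ℝ, 0 < ε₀ ∧
        (∀ (N : ℕ) (G : CandidateGenerator D N) (X : Fin N → Vec D) (q : Vec D),
          failureProbability K ε₀ G X q ≤ ENNReal.ofReal δ ∧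
          ∀ (i : Fin N) (α : ℝ), 0 < α →
            expectedCostAt K ε₀ G X q i α ≤ ENNReal.ofReal (C * costOrder D K δ α)) ∧
        (∀ (o q : Vec D) (r : ℝ), 0 < r → r < dist o q →
          expectedCost ε₀ o q r ≤
            ENNReal.ofReal (C * costOrder D K δ (distanceGap (dist o q) r)))) := by
  refine ⟨fun D N K ε₀ P X q L hD hK hε hL => ⟨fun T hT hs => ?_, fun i _ hpos => ⟨?_, fun hs => ?_⟩,
    otherCost_le _ _ _ _ _, otherCost_le _ _ _ _ _, fun hs => ?_⟩,
    74, by norm_num, fun D K δ hD hK hδ hδ1 => ⟨samplingParameter D K δ,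
      samplingParameter_pos hD hK hδ hδ1, fun N G X q =>
        ⟨failureProbability_le_of_samplingParameter hD hK hδ hδ1 G X q, fun i α hα =>
          expectedCostAt_le hD hK hδ hδ1 G X q i hα⟩,
      fun o q r hr hro => expectedCost_le hD hK hδ hδ1 hr hro⟩⟩
  · exact isKNN_returnedPlus hD hK hε P X q hL hT hs
  · rw [dcoPlus_eq]
    exact adLoop_snd_le _ _ _ _ (Nat.zero_le D)
  · exact dcoPlus_snd_of_succeeds hD hpos hs
  · exact scan_congr hL fun i hi => hs i hi
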